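/- Let $q\ge 2$ be an integer. There are positive constants $c_1,c_2,c_3$, depending only on $q$, such that the following holds for every $d\ge 1$, every $d$-regular bipartite (finite, simple, loopless) graph $G$ on $N\ge 1$ vertices, and every real $\varepsilon\ge c_1/\sqrt d$. Let $\chi$ be chosen uniformly at random from the proper $q$-colourings of $G$, and for a colour $k\in\{1,\dots,q\}$ write $\chi^{-1}(k)$ for the set of vertices of $G$ coloured $k$. If $q$ is even, then $$\Pr\left(\exists k:\ \left|\frac{|\chi^{-1}(k)|}{N}-\frac1q\right|\ge\varepsilon\right)\le c_2\,\varepsilon^{-1}\,2^{-c_3\varepsilon^2N}.$$ If $q$ is odd, then $$\Pr\left(\exists k:\ \frac{|\chi^{-1}(k)|}{N}\le\frac1{q+1}-\varepsilon\right)<c_2\,\varepsilon^{-1}\,2^{-c_3\varepsilon^2N}$$ and $$\Pr\left(\exists k:\ \frac{|\chi^{-1}(k)|}{N}\ge\frac1{q-1}+\varepsilon\right)<c_2\,\varepsilon^{-1}\,2^{-c_3\varepsilon^2N}.$$ -/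

import Mathlib

/-- The probability that a uniformly chosen proper `q`-colouring `χ` of the finite graph `G`
satisfies `P`: the number of proper `q`-colourings with `P` over the number of all of them.
(The denominator is nonzero as soon as `G` is bipartite and `2 ≤ q`.) -/
noncomputable def colouringProb {V : Type*} [Fintype V] (G : SimpleGraph V) (q : ℕ)
    (P : G.Coloring (Fin q) → Prop) : ℝ :=
  (Nat.card {χ : G.Coloring (Fin q) // P χ} : ℝ) / (Nat.card (G.Coloring (Fin q)) : ℝ)

/-- The proportion `|χ⁻¹(k)| / |V(G)|` of vertices of `G` that receive colour `k` under `χ`. -/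
noncomputable def colourProportion {V : Type*} [Fintype V] {G : SimpleGraph V} {q : ℕ}
    (χ : G.Coloring (Fin q)) (k : Fin q) : ℝ :=
  ((χ.colorClass k).ncard : ℝ) / (Fintype.card V : ℝ)

/-! The proof is a Chernoff argument on a partition function. Give colour `k` weight `1 + δ` and
every other colour weight 1. Summing out one side of the bipartition and applying Finner's
inequality to the neighbourhoods reduces the weighted colouring count of `G` to that of `K_{d,d}`
(`sum_coloring_prod_weight_le`): up to a factor `2 ^ (q / d)` per vertex of one side, it is at most
`M ^ (N / 2)`, where `M` bounds `w(A) * w(Aᶜ)` over all splits of the palette. Splitting the palette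
into `a + a' = q` colours gives at least `(a * a') ^ (N / 2)` unweighted colourings
(`card_coloring_ge`), so Markov's inequality applies to the ratio (`colouringProb_le_exp`).

For small `δ` the best split is still the balanced one, with `k` on the smaller side if `δ > 0` and
on the larger if `δ < 0`. On a side with `r` colours, `k` has typical share `1 / (2 * r)`: this is
`1 / q` for even `q`, and `1 / (q - 1)` or `1 / (q + 1)` for odd `q`. Taking `δ` of order `ε` makes
the exponent of order `-ε ^ 2 * N`; the error `q / d` is absorbed because `ε ≥ c₁ / √d`. -/

open MeasureTheory in
/-- **Finner's inequality** for functions each depending on a finite set of coordinates, such that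
every coordinate lies in exactly `d` of these sets. -/
theorem lmarginal_prod_le_prod_lmarginal_rpow {ι κ : Type*} [DecidableEq ι] [Fintype κ]
    {X : ι → Type*} [∀ i, MeasurableSpace (X i)] (μ : ∀ i, Measure (X i)) [∀ i, SigmaFinite (μ i)]
    (S : κ → Finset ι) (F : κ → (∀ i, X i) → ENNReal) (hF : ∀ v, Measurable (F v))
    (hdep : ∀ v, DependsOn (F v) (S v)) (d : ℕ) (hd : 0 < d)
    (hcard : ∀ i, (Finset.univ.filter (fun v => i ∈ S v)).card = d) (s : Finset ι)
    (x : ∀ i, X i) :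
    lmarginal μ s (fun x => ∏ v, F v x) x ≤
      ∏ v, (lmarginal μ (s ∩ S v) (fun x => F v x ^ (d : ℝ)) x) ^ (1 / (d : ℝ)) := by
  have hd' : (d : ℝ) ≠ 0 := by positivity
  have hFd : ∀ v, Measurable fun x => F v x ^ (d : ℝ) := fun v => (hF v).pow_const _
  induction s using Finset.induction_on generalizing x with
  | empty =>
    simp only [lmarginal_empty, Finset.empty_inter]
    refine Finset.prod_le_prod' fun v _ => ?_
    rw [← ENNReal.rpow_mul, mul_one_div_cancel hd', ENNReal.rpow_one]
  | insert i s hi ih =>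
    rw [lmarginal_insert _ (Finset.measurable_prod _ fun v _ => hF v) hi]
    refine (lintegral_mono fun a => ih (Function.update x i a)).trans ?_
    have hconst : ∀ v, i ∉ S v → ∀ a,
        lmarginal μ (s ∩ S v) (fun x => F v x ^ (d : ℝ)) (Function.update x i a) =
          lmarginal μ (insert i s ∩ S v) (fun x => F v x ^ (d : ℝ)) x := by
      intro v hv a
      rw [Finset.insert_inter_of_notMem hv]
      simp only [lmarginal]
      refine lintegral_congr fun y => ?_
      congr 1
      refine hdep v fun j hj => ?_
      have hji : j ≠ i := fun h => hv (by simpa [h] using hj)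
      simp [Function.updateFinset, Function.update, hji]
    simp_rw [← Finset.prod_filter_mul_prod_filter_not Finset.univ (fun v => i ∈ S v)]
    have h2 : ∀ a, (∏ v with i ∉ S v,
        (lmarginal μ (s ∩ S v) (fun x => F v x ^ (d : ℝ)) (Function.update x i a)) ^ (1 / (d : ℝ)))
        = ∏ v with i ∉ S v,
        (lmarginal μ (insert i s ∩ S v) (fun x => F v x ^ (d : ℝ)) x) ^ (1 / (d : ℝ)) := by
      intro a
      refine Finset.prod_congr rfl fun v hv => ?_
      rw [hconst v (by simpa using hv) a]
    simp_rw [h2]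
    have hmeas : ∀ v, Measurable fun a =>
        lmarginal μ (s ∩ S v) (fun x => F v x ^ (d : ℝ)) (Function.update x i a) :=
      fun v => ((hFd v).lmarginal μ).comp (measurable_update x)
    rw [lintegral_mul_const _ (Finset.measurable_prod _ fun v _ => (hmeas v).pow_const _)]
    gcongr
    -- Hölder in coordinate `i`: exactly `d` factors involve it, each with exponent `1 / d`, so the
    -- exponents sum to 1.
    refine (ENNReal.lintegral_prod_norm_pow_le _ (fun v _ => (hmeas v).aemeasurable) ?_
      fun _ _ => by positivity).trans ?_
    · rw [Finset.sum_const, hcard, nsmul_eq_mul, mul_one_div_cancel hd']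
    · refine Finset.prod_le_prod' fun v hv => ?_
      rw [Finset.insert_inter_of_mem (by simpa using hv),
        lmarginal_insert _ (hFd v) (fun h => hi (Finset.mem_inter.mp h).1)]

open MeasureTheory in
/-- Finner's inequality for finite weighted sums. -/
theorem sum_weight_mul_prod_le {ι κ Q : Type*} [DecidableEq ι] [Fintype ι] [Fintype κ] [Fintype Q]
    (w : Q → NNReal) (S : κ → Finset ι) (F : κ → (ι → Q) → ENNReal)
    (hdep : ∀ v, DependsOn (F v) (S v)) (d : ℕ) (hd : 0 < d)
    (hcard : ∀ i, (Finset.univ.filter (fun v => i ∈ S v)).card = d) (x₀ : ι → Q) :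
    ∑ x : ι → Q, (∏ v, F v x) * ∏ i, (w (x i) : ENNReal) ≤
      ∏ v, (∑ y : S v → Q, F v (Function.updateFinset x₀ (S v) y) ^ (d : ℝ) *
        ∏ i, (w (y i) : ENNReal)) ^ (1 / (d : ℝ)) := by
  classical
  let _ : MeasurableSpace Q := ⊤
  have : MeasurableSingletonClass Q := ⟨fun _ => trivial⟩
  let ν : Measure Q := Measure.count.withDensity fun c => (w c : ENNReal)
  have hν : ∀ c, ν {c} = w c := fun c => by
    rw [withDensity_apply _ (measurableSet_singleton c), Measure.restrict_singleton,
      Measure.count_singleton, one_smul, lintegral_dirac]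
  have : IsFiniteMeasure ν := isFiniteMeasure_withDensity (by
    rw [lintegral_fintype]
    simp [ENNReal.sum_eq_top])
  have key := lmarginal_prod_le_prod_lmarginal_rpow (fun _ : ι => ν) S F
    (fun v => measurable_of_finite _) hdep d hd hcard Finset.univ x₀
  rw [lmarginal_univ] at key
  simp_rw [Finset.univ_inter, lmarginal, lintegral_fintype, Measure.pi_singleton, hν] at key
  exact key

/-! ### Weighted colourings of regular bipartite graphs -/

/-- The weighted number of pairs `(y, z)` of maps from a `d`-set to `Q` with disjoint ranges is at
most `2 ^ |Q| * M ^ d` if `M` bounds the weight of all complementary pairs. -/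
theorem sum_weight_compl_range_pow_le {T Q : Type*} [Fintype T] [DecidableEq T] [Fintype Q]
    [DecidableEq Q] (W : Q → ENNReal) (M : ENNReal)
    (hM : ∀ A : Finset Q, (∑ c ∈ A, W c) * ∑ c ∈ Aᶜ, W c ≤ M) :
    ∑ y : T → Q, (∑ c ∈ (Finset.univ.image y)ᶜ, W c) ^ Fintype.card T * ∏ i, W (y i) ≤
      2 ^ Fintype.card Q * M ^ Fintype.card T := by
  have h1 : ∀ y : T → Q,
      (∑ c ∈ (Finset.univ.image y)ᶜ, W c) ^ Fintype.card T * ∏ i, W (y i) ≤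
      ∑ A : Finset Q, (∑ c ∈ Aᶜ, W c) ^ Fintype.card T *
        ∏ i, (if y i ∈ A then W (y i) else 0) := by
    -- The summand `A = range y` is the left-hand side. Relaxing to all `A` costs the factor `2 ^
    -- |Q|`, but makes the sum over `y` factorise.
    intro y
    refine le_trans (le_of_eq ?_) (Finset.single_le_sum (fun _ _ => zero_le)
      (Finset.mem_univ (Finset.univ.image y)))
    congr 1
    exact Finset.prod_congr rfl fun i _ => by simp
  refine (Finset.sum_le_sum fun y _ => h1 y).trans ?_
  rw [Finset.sum_comm]
  have h2 : ∀ A : Finset Q, ∑ y : T → Q, (∑ c ∈ Aᶜ, W c) ^ Fintype.card T *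
      ∏ i, (if y i ∈ A then W (y i) else 0) ≤ M ^ Fintype.card T := by
    intro A
    rw [← Finset.mul_sum]
    have := Finset.prod_univ_sum (fun _ : T => (Finset.univ : Finset Q))
      (fun _ c => if c ∈ A then W c else 0)
    rw [Fintype.piFinset_univ] at this
    rw [← this, Finset.prod_const, Finset.card_univ, ← mul_pow, Finset.sum_ite_mem,
      Finset.univ_inter, mul_comm]
    exact pow_le_pow_left' (hM A) _
  refine (Finset.sum_le_sum fun A _ => h2 A).trans ?_
  simp

/-- Summing out the colours of one side of a bipartite graph. -/
theorem sum_coloring_prod_weight_le_sum_prod {V Q : Type*} [Fintype V] [Fintype Q]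
    [DecidableEq V] [DecidableEq Q] (G : SimpleGraph V) [Fintype (G.Coloring Q)] [DecidableRel G.Adj]
    (p : V → Prop) [DecidablePred p] (w : Q → NNReal) :
    ∑ χ : G.Coloring Q, ∏ v, (w (χ v) : ENNReal) ≤
      ∑ x : {v // p v} → Q, (∏ v : {v // ¬ p v}, ∑ c ∈ ((Finset.univ.filter
        fun e : {v // p v} => G.Adj e.1 v.1).image x)ᶜ, (w c : ENNReal)) *
          ∏ i, (w (x i) : ENNReal) := by
  let S : {v // ¬ p v} → Finset {v // p v} := fun v =>
    Finset.univ.filter fun e => G.Adj e.1 v.1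
  have hF : ∀ x, ∏ v : {v // ¬ p v}, ∑ c ∈ ((Finset.univ.filter
      fun e : {v // p v} => G.Adj e.1 v.1).image x)ᶜ, (w c : ENNReal) = ∑ z : {v // ¬ p v} → Q,
      ∏ v, (if z v ∈ ((S v).image x)ᶜ then (w (z v) : ENNReal) else 0) := by
    intro x
    have := Finset.prod_univ_sum (fun _ : {v // ¬ p v} => (Finset.univ : Finset Q))
      (fun v c => if c ∈ ((S v).image x)ᶜ then (w c : ENNReal) else 0)
    rw [Fintype.piFinset_univ] at this
    rw [← this]
    refine Finset.prod_congr rfl fun v _ => ?_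
    rw [Finset.sum_ite_mem, Finset.univ_inter]
  simp_rw [hF, Finset.sum_mul]
  rw [← Fintype.sum_prod_type' (f := fun (x : {v // p v} → Q) (z : {v // ¬ p v} → Q) =>
    (∏ v, (if z v ∈ ((S v).image x)ᶜ then (w (z v) : ENNReal) else 0)) *
      ∏ i, (w (x i) : ENNReal))]
  let r : G.Coloring Q → ({v // p v} → Q) × ({v // ¬ p v} → Q) :=
    fun χ => (fun e => χ e.1, fun v => χ v.1)
  have hr : Function.Injective r := by
    intro χ ψ h
    refine DFunLike.ext _ _ fun v => ?_
    by_cases hv : p v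
    · exact congrFun (congrArg Prod.fst h) ⟨v, hv⟩
    · exact congrFun (congrArg Prod.snd h) ⟨v, hv⟩
  have hterm : ∀ χ : G.Coloring Q, ∏ v, (w (χ v) : ENNReal) =
      (∏ v, (if (r χ).2 v ∈ ((S v).image (r χ).1)ᶜ then (w ((r χ).2 v) : ENNReal) else 0)) *
      ∏ i, (w ((r χ).1 i) : ENNReal) := by
    intro χ
    rw [← Fintype.prod_subtype_mul_prod_subtype p, mul_comm]
    congr 1
    refine Finset.prod_congr rfl fun v _ => ?_
    rw [if_pos]
    simp only [Finset.mem_compl, Finset.mem_image, not_exists, not_and, r, S]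
    intro e he
    exact χ.valid (by simpa using he)
  simp_rw [hterm]
  refine (Finset.sum_map Finset.univ ⟨r, hr⟩ (fun xz =>
    (∏ v, (if xz.2 v ∈ ((S v).image xz.1)ᶜ then (w (xz.2 v) : ENNReal) else 0)) *
      ∏ i, (w (xz.1 i) : ENNReal))).symm.le.trans ?_
  exact Finset.sum_le_sum_of_subset (Finset.subset_univ _)

/-- **The Galvin–Tetali bound** for weighted colourings of a regular bipartite graph. -/
theorem sum_coloring_prod_weight_le {V Q : Type*} [Fintype V] [Fintype Q] [Nonempty Q]
    (G : SimpleGraph V) [G.LocallyFinite] [Fintype (G.Coloring Q)] {d : ℕ} (hd : 0 < d)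
    (hreg : G.IsRegularOfDegree d)
    (p : V → Prop) [DecidablePred p] (hp : ∀ u v, G.Adj u v → (p u ↔ ¬ p v))
    (w : Q → NNReal) (M : ENNReal) [DecidableEq Q]
    (hM : ∀ A : Finset Q, (∑ c ∈ A, (w c : ENNReal)) * ∑ c ∈ Aᶜ, (w c : ENNReal) ≤ M) :
    ∑ χ : G.Coloring Q, ∏ v, (w (χ v) : ENNReal) ≤
      ((2 ^ Fintype.card Q * M ^ d) ^ (1 / (d : ℝ))) ^ Fintype.card {v // ¬ p v} := by
  classical
  let S : {v // ¬ p v} → Finset {v // p v} := fun v =>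
    Finset.univ.filter fun e => G.Adj e.1 v.1
  let F : {v // ¬ p v} → ({v // p v} → Q) → ENNReal := fun v x =>
    ∑ c ∈ ((S v).image x)ᶜ, (w c : ENNReal)
  have hdep : ∀ v, DependsOn (F v) (S v) := by
    intro v x y hxy
    have : (S v).image x = (S v).image y := Finset.image_congr hxy
    simp only [F, this]
  have hcardS : ∀ v, (S v).card = d := by
    intro v
    rw [← hreg v.1, ← SimpleGraph.card_neighborFinset_eq_degree]
    refine Finset.card_bij (fun e _ => e.1) ?_ ?_ ?_
    · intro e he
      simpa [S, G.adj_comm] using he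
    · intro a _ b _ h
      exact Subtype.ext h
    · intro b hb
      have hb' : G.Adj b v := by simpa [G.adj_comm] using hb
      exact ⟨⟨b, (hp _ _ hb').2 v.2⟩, by simpa [S] using hb', rfl⟩
  have hcard : ∀ e, (Finset.univ.filter (fun v => e ∈ S v)).card = d := by
    intro e
    rw [← hreg e.1, ← SimpleGraph.card_neighborFinset_eq_degree]
    refine Finset.card_bij (fun v _ => v.1) ?_ ?_ ?_
    · intro v hv
      simpa [S] using hv
    · intro a _ b _ h
      exact Subtype.ext h
    · intro b hb
      have hb' : G.Adj e b := by simpa using hb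
      exact ⟨⟨b, (hp _ _ hb').1 e.2⟩, by simpa [S] using hb', rfl⟩
  have hcount := sum_coloring_prod_weight_le_sum_prod G p w
  obtain ⟨c₀⟩ := ‹Nonempty Q›
  -- Each local factor is the weighted colouring count of `K_{d,d}`. The default colour `c₀` is
  -- never seen, since `F v` reads only `S v`.
  have hvert : ∀ v, ∑ y : S v → Q, F v (Function.updateFinset (fun _ => c₀) (S v) y) ^ (d : ℝ) *
      ∏ i, (w (y i) : ENNReal) ≤ 2 ^ Fintype.card Q * M ^ d := by
    intro v
    have := sum_weight_compl_range_pow_le (T := S v) (fun c : Q => (w c : ENNReal)) M hM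
    rw [Fintype.card_coe, hcardS] at this
    refine le_trans (le_of_eq ?_) this
    refine Finset.sum_congr rfl fun y _ => ?_
    rw [ENNReal.rpow_natCast]
    have himg : (S v).image (Function.updateFinset (fun _ => c₀) (S v) y) =
        Finset.univ.image y := by
      ext c
      simp only [Finset.mem_image, Finset.mem_univ, true_and, Function.updateFinset]
      constructor
      · rintro ⟨e, he, rfl⟩
        exact ⟨⟨e, he⟩, by rw [dif_pos he]⟩
      · rintro ⟨e, rfl⟩
        exact ⟨e.1, e.2, by rw [dif_pos e.2]⟩
    simp only [F, himg]
  refine hcount.trans ((sum_weight_mul_prod_le w S F hdep d hd hcard fun _ => c₀).trans ?_)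
  exact Finset.prod_le_pow_card _ _ _ fun v _ => ENNReal.rpow_le_rpow (hvert v) (by positivity)

/-! ### Lower bound on the number of colourings, and elementary estimates -/

theorem card_coloring_ge {V : Type*} [Fintype V] (G : SimpleGraph V)
    (p : V → Prop) [DecidablePred p] (hp : ∀ u v, G.Adj u v → (p u ↔ ¬ p v)) (a b : ℕ) :
    a ^ Fintype.card {v // p v} * b ^ Fintype.card {v // ¬ p v} ≤
      Nat.card (G.Coloring (Fin (a + b))) := by
  classical
  let f : ({v // p v} → Fin a) × ({v // ¬ p v} → Fin b) → G.Coloring (Fin (a + b)) := fun xz =>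
    SimpleGraph.Coloring.mk
      (fun v => if h : p v then Fin.castAdd b (xz.1 ⟨v, h⟩) else Fin.natAdd a (xz.2 ⟨v, h⟩)) (by
        intro u v huv
        have := hp u v huv
        by_cases hu : p u
        · have hv : ¬ p v := this.1 hu
          simp only [hu, hv, dif_pos, not_false_eq_true, dif_neg, ne_eq, Fin.ext_iff,
            Fin.val_castAdd, Fin.val_natAdd]
          omega
        · have hv : p v := by tauto
          simp only [hu, hv, dif_pos, not_false_eq_true, dif_neg, ne_eq, Fin.ext_iff,
            Fin.val_castAdd, Fin.val_natAdd]
          omega)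
  have hfv : ∀ xz v, f xz v =
      if h : p v then Fin.castAdd b (xz.1 ⟨v, h⟩) else Fin.natAdd a (xz.2 ⟨v, h⟩) :=
    fun _ _ => rfl
  have hf : Function.Injective f := by
    intro x y h
    have h' : ∀ v, f x v = f y v := fun v => by rw [h]
    refine Prod.ext (funext fun v => ?_) (funext fun v => ?_)
    · have := h' v.1
      simpa [hfv, v.2, Fin.ext_iff] using this
    · have := h' v.1
      simpa [hfv, v.2, Fin.ext_iff] using this
  have : Finite (G.Coloring (Fin (a + b))) := DFunLike.finite _
  have := Nat.card_le_card_of_injective f hf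
  simpa [Nat.card_eq_fintype_card] using this

/-- Double counting: each side meets every edge exactly once, and each of its vertices lies on `d`
edges. -/
theorem card_sides_eq {V : Type*} [Fintype V] (G : SimpleGraph V) [G.LocallyFinite] {d : ℕ}
    (hd : 0 < d) (hreg : G.IsRegularOfDegree d)
    (p : V → Prop) [DecidablePred p] (hp : ∀ u v, G.Adj u v → (p u ↔ ¬ p v)) :
    Fintype.card {v // p v} = Fintype.card {v // ¬ p v} := by
  have h : G.IsBipartiteWith ((Finset.univ.filter p : Finset V) : Set V)
      ((Finset.univ.filter fun v => ¬ p v : Finset V) : Set V) := by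
    constructor
    · rw [Finset.disjoint_coe]
      exact Finset.disjoint_filter_filter_not _ _ _
    · intro u v huv
      have := hp u v huv
      simp only [Finset.coe_filter, Finset.mem_univ, true_and, Set.mem_ofPred_eq]
      tauto
  have := SimpleGraph.isBipartiteWith_sum_degrees_eq h
  simp only [hreg _, Finset.sum_const, smul_eq_mul] at this
  rw [Fintype.card_subtype, Fintype.card_subtype]
  exact Nat.eq_of_mul_eq_mul_right hd this

theorem sub_two_mul_sq_le_log_one_add {δ : ℝ} (h : -(1 / 2) ≤ δ) :
    δ - 2 * δ ^ 2 ≤ Real.log (1 + δ) := by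
  have hpos : 0 < 1 + δ := by linarith
  refine le_trans ?_ (Real.one_sub_inv_le_log_of_pos hpos)
  have : 1 - (1 + δ)⁻¹ - (δ - 2 * δ ^ 2) = δ ^ 2 * (1 + 2 * δ) / (1 + δ) := by
    field_simp
    ring
  have h2 : 0 ≤ δ ^ 2 * (1 + 2 * δ) / (1 + δ) := by
    have : 0 ≤ 1 + 2 * δ := by linarith
    positivity
  linarith

theorem sum_coloring_prod_weight_le_real {V Q : Type*} [Fintype V] [Fintype Q] [Nonempty Q]
    [DecidableEq Q] (G : SimpleGraph V) [G.LocallyFinite] [Fintype (G.Coloring Q)] {d : ℕ}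
    (hd : 0 < d) (hreg : G.IsRegularOfDegree d)
    (p : V → Prop) [DecidablePred p] (hp : ∀ u v, G.Adj u v → (p u ↔ ¬ p v))
    (w : Q → NNReal) (M : NNReal)
    (hM : ∀ A : Finset Q, (∑ c ∈ A, w c) * ∑ c ∈ Aᶜ, w c ≤ M) :
    ∑ χ : G.Coloring Q, ∏ v, (w (χ v) : ℝ) ≤
      (((2 : ℝ) ^ Fintype.card Q * (M : ℝ) ^ d) ^ (1 / (d : ℝ))) ^ Fintype.card {v // ¬ p v} := by
  have hZ := sum_coloring_prod_weight_le G hd hreg p hp w M (fun A => by exact_mod_cast hM A)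
  have h1 : ((∑ χ : G.Coloring Q, ∏ v, w (χ v) : NNReal) : ENNReal) ≤
      (((((2 : NNReal) ^ Fintype.card Q * M ^ d) ^ (1 / (d : ℝ))) ^ Fintype.card {v // ¬ p v} :
        NNReal) : ENNReal) := by
    rw [ENNReal.coe_pow, ENNReal.coe_rpow_of_nonneg _ (by positivity)]
    push_cast
    exact hZ
  have h2 := ENNReal.coe_le_coe.1 h1
  rw [← NNReal.coe_le_coe] at h2
  push_cast at h2
  exact h2

theorem two_pow_mul_pow_rpow_pow_le {q d n : ℕ} (hd : 0 < d) {L m M : ℝ} (hL : 0 ≤ L)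
    (hM : M = L * Real.exp m) :
    (((2 : ℝ) ^ q * M ^ d) ^ (1 / (d : ℝ))) ^ n ≤ L ^ n * Real.exp ((m + (q : ℝ) / d) * n) := by
  have hd' : (d : ℝ) ≠ 0 := by positivity
  have hM0 : 0 ≤ M := by rw [hM]; positivity
  rw [Real.mul_rpow (by positivity) (by positivity), ← Real.rpow_natCast M d,
    ← Real.rpow_mul hM0, mul_one_div_cancel hd', Real.rpow_one]
  have h2 : ((2 : ℝ) ^ q) ^ (1 / (d : ℝ)) ≤ Real.exp ((q : ℝ) / d) := by
    have : ((2 : ℝ) ^ q) ≤ Real.exp (q : ℝ) := by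
      rw [← mul_one (q : ℝ), Real.exp_nat_mul]
      have := Real.add_one_le_exp 1
      gcongr
      linarith
    calc ((2 : ℝ) ^ q) ^ (1 / (d : ℝ))
        ≤ Real.exp (q : ℝ) ^ (1 / (d : ℝ)) := by gcongr
      _ = _ := by rw [← Real.exp_mul, mul_one_div]
  calc (((2 : ℝ) ^ q) ^ (1 / (d : ℝ)) * M) ^ n
      ≤ (Real.exp ((q : ℝ) / d) * M) ^ n := by gcongr
    _ = _ := by
      rw [hM, mul_comm _ (n : ℝ), Real.exp_nat_mul, ← mul_pow, Real.exp_add]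
      ring

theorem prod_ite_eq_exp_ncard_colorClass {V Q : Type*} [Fintype V] [DecidableEq Q]
    {G : SimpleGraph V} (χ : G.Coloring Q) (k : Q) {x : ℝ} (hx : 0 < x) :
    ∏ v, (if χ v = k then x else 1) = Real.exp ((χ.colorClass k).ncard * Real.log x) := by
  rw [Real.exp_nat_mul, Real.exp_log hx, ← Finset.prod_filter, Finset.prod_const,
    ← Set.ncard_coe_finset]
  congr 2
  ext v
  simp [SimpleGraph.Coloring.colorClass]

theorem card_subtype_mul_le_sum {α : Type*} [Fintype α] (P : α → Prop) (f : α → ℝ) (t : ℝ)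
    (hf : ∀ x, 0 ≤ f x) (hP : ∀ x, P x → t ≤ f x) : (Nat.card {x // P x} : ℝ) * t ≤ ∑ x, f x := by
  classical
  rw [Nat.card_eq_fintype_card, Fintype.card_subtype, ← nsmul_eq_mul]
  refine (Finset.card_nsmul_le_sum _ f _ fun x hx => hP x (by simpa using hx)).trans
    (Finset.sum_le_sum_of_subset_of_nonneg (Finset.filter_subset _ _) fun x _ _ => hf x)

/-! ### Tail bounds for colour classes -/

/-- Exponential Markov inequality for a single colour class: the colour `k` gets weight `1 + δ`. -/
theorem colouringProb_le_exp {V : Type*} [Fintype V] (G : SimpleGraph V) [G.LocallyFinite]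
    {d : ℕ} (hd : 0 < d) (hreg : G.IsRegularOfDegree d) (hbip : G.IsBipartite)
    {a a' : ℕ} (ha : 0 < a) (ha' : 0 < a') (k : Fin (a + a')) {δ m u : ℝ} (hδ : -1 < δ)
    (hopt : ∀ j : ℤ, (j + δ) * (a + a' - j) ≤ a * a' * (1 + m))
    (P : G.Coloring (Fin (a + a')) → Prop)
    (hP : ∀ χ, P χ → u ≤ (χ.colorClass k).ncard * Real.log (1 + δ)) :
    colouringProb G (a + a') P ≤
      Real.exp (-u + (m + ((a + a' : ℕ) : ℝ) / d) * (Fintype.card V / 2)) := by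
  classical
  obtain ⟨C⟩ := hbip
  let p : V → Prop := fun v => C v = 0
  have hp : ∀ u v, G.Adj u v → (p u ↔ ¬ p v) := by
    intro u v huv
    have := C.valid huv
    simp only [p]
    omega
  have : Finite (G.Coloring (Fin (a + a'))) := DFunLike.finite _
  have : Fintype (G.Coloring (Fin (a + a'))) := Fintype.ofFinite _
  set n := Fintype.card {v // ¬ p v} with hn
  have hside := card_sides_eq G hd hreg p hp
  have hN : (Fintype.card V : ℝ) / 2 = n := by
    have := Fintype.card_subtype_compl p
    have h3 := Fintype.card_subtype_le p
    have : Fintype.card V = n + n := by omega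
    rw [this]; push_cast; ring
  have hcol := card_coloring_ge G p hp a a'
  rw [hside, ← hn, ← mul_pow] at hcol
  have hpos : 0 < 1 + δ := by linarith
  obtain ⟨lam, hlam⟩ : ∃ lam : NNReal, (lam : ℝ) = 1 + δ := ⟨⟨1 + δ, hpos.le⟩, rfl⟩
  let w : Fin (a + a') → NNReal := fun c => if c = k then lam else 1
  have hL : 0 < (a * a' : ℝ) := by positivity
  obtain ⟨M, hMdef⟩ : ∃ M : NNReal, (M : ℝ) = a * a' * Real.exp m :=
    ⟨⟨a * a' * Real.exp m, by positivity⟩, rfl⟩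
  have : Nonempty (Fin (a + a')) := ⟨k⟩
  have hwsum : ∀ A : Finset (Fin (a + a')), ((∑ c ∈ A, w c : NNReal) : ℝ) =
      A.card + if k ∈ A then δ else 0 := by
    intro A
    have : ∀ c, ((w c : NNReal) : ℝ) = 1 + if c = k then δ else 0 := by
      intro c
      simp only [w]
      split_ifs
      · exact hlam
      · simp
    rw [NNReal.coe_sum]
    simp_rw [this]
    rw [Finset.sum_add_distrib, Finset.sum_ite_eq' A k]
    simp
  have hMr : ∀ A : Finset (Fin (a + a')), (∑ c ∈ A, w c) * ∑ c ∈ Aᶜ, w c ≤ M := by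
    intro A
    rw [← NNReal.coe_le_coe, NNReal.coe_mul, hwsum, hwsum]
    have hcard : ((Aᶜ.card : ℕ) : ℝ) = a + a' - A.card := by
      have := Finset.card_add_card_compl A
      rw [Fintype.card_fin] at this
      have h2 : (A.card : ℝ) + Aᶜ.card = a + a' := by exact_mod_cast this
      linarith
    have hM' : (a * a' * (1 + m) : ℝ) ≤ M := by
      rw [hMdef]
      have := Real.add_one_le_exp m
      gcongr
      linarith
    refine le_trans ?_ hM'
    -- The product is symmetric in `A` and `Aᶜ`, so `hopt` is used with `j` the size of the part
    -- containing `k`.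
    by_cases hk : k ∈ A
    · have := hopt A.card
      simp only [hk, if_true, Finset.mem_compl, not_true_eq_false, if_false, add_zero, hcard]
      exact_mod_cast this
    · have := hopt Aᶜ.card
      simp only [hk, if_false, Finset.mem_compl, not_false_eq_true, if_true, add_zero]
      push_cast at this
      rw [hcard] at this ⊢
      linarith
  have hZ := sum_coloring_prod_weight_le_real G hd hreg p hp w M hMr
  rw [← hn, Fintype.card_fin] at hZ
  have hbound := two_pow_mul_pow_rpow_pow_le (q := a + a') (n := n) hd hL.le hMdef
  have hprod : ∀ χ : G.Coloring (Fin (a + a')), ∏ v, (w (χ v) : ℝ) =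
      Real.exp ((χ.colorClass k).ncard * Real.log (1 + δ)) := by
    intro χ
    rw [← prod_ite_eq_exp_ncard_colorClass χ k hpos]
    refine Finset.prod_congr rfl fun v _ => ?_
    simp only [w]
    split_ifs
    · exact hlam
    · rfl
  have hmarkov : (Nat.card {χ // P χ} : ℝ) * Real.exp u ≤
      ∑ χ : G.Coloring (Fin (a + a')), ∏ v, (w (χ v) : ℝ) := by
    refine card_subtype_mul_le_sum P _ _ (fun χ => by positivity) fun χ hχ => ?_
    rw [hprod]
    exact Real.exp_le_exp.2 (hP χ hχ)
  have hcolr : (a * a' : ℝ) ^ n ≤ Nat.card (G.Coloring (Fin (a + a'))) := by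
    exact_mod_cast hcol
  have hfin : (Nat.card {χ // P χ} : ℝ) * Real.exp u ≤
      Nat.card (G.Coloring (Fin (a + a'))) *
        Real.exp ((m + ((a + a' : ℕ) : ℝ) / d) * n) :=
    ((hmarkov.trans hZ).trans hbound).trans (by gcongr)
  have hc0 : (0 : ℝ) < Nat.card (G.Coloring (Fin (a + a'))) := lt_of_lt_of_le (by positivity) hcolr
  rw [colouringProb, div_le_iff₀ hc0, hN, Real.exp_add, Real.exp_neg, mul_assoc,
    inv_mul_eq_div, le_div_iff₀ (Real.exp_pos u)]
  linarith

/-- Large deviations of a colour class: upper tail for `s = 1`, lower tail for `s = -1`. -/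
theorem colouringProb_tail_le {V : Type*} [Fintype V] [Nonempty V] (G : SimpleGraph V)
    [G.LocallyFinite] {d : ℕ} (hd : 0 < d) (hreg : G.IsRegularOfDegree d) (hbip : G.IsBipartite)
    {a a' : ℕ} (ha : 0 < a) (ha' : 0 < a') (k : Fin (a + a')) {s b ε : ℝ} (hs : s = 1 ∨ s = -1)
    (hb : b ≤ 1) (hε : 0 ≤ ε) (hε1 : ε ≤ 1) (hdε : 16 * ((a + a' : ℕ) : ℝ) ≤ d * ε ^ 2)
    (hopt : ∀ j : ℤ, (j + s * ε / 8) * (a + a' - j) ≤ a * a' * (1 + 2 * b * (s * ε / 8)))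
    (P : G.Coloring (Fin (a + a')) → Prop)
    (hP : ∀ χ, P χ → s * b + ε ≤ s * colourProportion χ k) :
    colouringProb G (a + a') P ≤ Real.exp (-(ε ^ 2 * Fintype.card V / 32)) := by
  have hNpos : (0 : ℝ) < Fintype.card V := by exact_mod_cast Fintype.card_pos
  set N : ℝ := (Fintype.card V : ℝ) with hN
  set δ : ℝ := s * ε / 8 with hδ
  have hs2 : s ^ 2 = 1 := by rcases hs with rfl | rfl <;> norm_num
  have hδabs : -(1 / 8) ≤ δ ∧ δ ≤ 1 / 8 := by
    rcases hs with rfl | rfl <;> constructor <;> linarith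
  have hlog : δ - 2 * δ ^ 2 ≤ Real.log (1 + δ) :=
    sub_two_mul_sq_le_log_one_add (by linarith [hδabs.1])
  refine (colouringProb_le_exp G hd hreg hbip ha ha' k (u := (b + s * ε) * N * (δ - 2 * δ ^ 2))
    (by linarith [hδabs.1]) hopt P ?_).trans (Real.exp_le_exp.2 ?_)
  · intro χ hχ
    have h := hP χ hχ
    set c : ℝ := ((χ.colorClass k).ncard : ℝ)
    have hc : 0 ≤ c := Nat.cast_nonneg _
    have hcp : colourProportion χ k = c / N := rfl
    rw [hcp] at h
    refine le_trans ?_ (mul_le_mul_of_nonneg_left hlog hc)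
    have h' : (s * b + ε) * N ≤ s * c := by
      have := mul_le_mul_of_nonneg_right h hNpos.le
      rwa [mul_assoc s, div_mul_cancel₀ _ hNpos.ne'] at this
    have hfac : δ - 2 * δ ^ 2 = s * (ε / 8 * (1 - 2 * δ)) := by rw [hδ]; ring
    have hnn : 0 ≤ ε / 8 * (1 - 2 * δ) := mul_nonneg (by linarith) (by linarith [hδabs.2])
    have := mul_le_mul_of_nonneg_right h' hnn
    rw [hfac]
    calc (b + s * ε) * N * (s * (ε / 8 * (1 - 2 * δ)))
        = (s * b + s ^ 2 * ε) * N * (ε / 8 * (1 - 2 * δ)) := by ring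
      _ = (s * b + ε) * N * (ε / 8 * (1 - 2 * δ)) := by rw [hs2, one_mul]
      _ ≤ s * c * (ε / 8 * (1 - 2 * δ)) := this
      _ = _ := by ring
  -- The terms linear in `b * δ` cancel. Per vertex there remains at most `-ε²/8 + ε²/16 + ε²/32 =
  -- -ε²/32`.
  · have hq : ((a + a' : ℕ) : ℝ) / d ≤ ε ^ 2 / 16 := by
      rw [div_le_iff₀ (by positivity)]
      linarith
    have hδ2 : δ ^ 2 = ε ^ 2 / 64 := by
      rw [hδ, div_pow, mul_pow, hs2]; ring
    have hsδ : s * ε * δ = ε ^ 2 / 8 := by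
      rw [hδ]; linear_combination ε ^ 2 / 8 * hs2
    have hbs : b + s * ε ≤ 2 := by rcases hs with rfl | rfl <;> linarith
    have h1 : (b + s * ε) * ε ^ 2 ≤ 2 * ε ^ 2 := by gcongr
    have e : -((b + s * ε) * N * (δ - 2 * δ ^ 2)) +
        (2 * b * δ + ((a + a' : ℕ) : ℝ) / d) * (N / 2) =
        N * (-(s * ε * δ) + 2 * (b + s * ε) * δ ^ 2 + ((a + a' : ℕ) : ℝ) / d / 2) := by ring
    rw [e, hsδ, hδ2]
    have : N * (-(ε ^ 2 / 8) + 2 * (b + s * ε) * (ε ^ 2 / 64) + ((a + a' : ℕ) : ℝ) / d / 2) ≤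
        N * (-(ε ^ 2 / 32)) := by
      gcongr
      linarith
    linarith

theorem colourProportion_nonneg {V : Type*} [Fintype V] {G : SimpleGraph V} {q : ℕ}
    (χ : G.Coloring (Fin q)) (k : Fin q) : 0 ≤ colourProportion χ k := by
  unfold colourProportion
  positivity

theorem colourProportion_le_one {V : Type*} [Fintype V] {G : SimpleGraph V} {q : ℕ}
    (χ : G.Coloring (Fin q)) (k : Fin q) : colourProportion χ k ≤ 1 := by
  unfold colourProportion
  refine div_le_one_of_le₀ ?_ (Nat.cast_nonneg _)
  have := Set.ncard_le_card (χ.colorClass k)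
  rw [Nat.card_eq_fintype_card] at this
  exact_mod_cast this

theorem colouringProb_eq_zero {V : Type*} [Fintype V] (G : SimpleGraph V) {q : ℕ}
    (P : G.Coloring (Fin q) → Prop) (h : ∀ χ, ¬ P χ) : colouringProb G q P = 0 := by
  have : IsEmpty {χ // P χ} := ⟨fun χ => h χ.1 χ.2⟩
  simp [colouringProb]

/-- Union bound. -/
theorem colouringProb_le_sum {V ι : Type*} [Fintype V] [Fintype ι] (G : SimpleGraph V) {q : ℕ}
    (P : G.Coloring (Fin q) → Prop) (R : ι → G.Coloring (Fin q) → Prop)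
    (h : ∀ χ, P χ → ∃ i, R i χ) : colouringProb G q P ≤ ∑ i, colouringProb G q (R i) := by
  classical
  have : Finite (G.Coloring (Fin q)) := DFunLike.finite _
  have : Fintype (G.Coloring (Fin q)) := Fintype.ofFinite _
  unfold colouringProb
  rw [← Finset.sum_div]
  gcongr
  simp_rw [Nat.card_eq_fintype_card, Fintype.card_subtype]
  norm_cast
  refine (Finset.card_le_card ?_).trans Finset.card_biUnion_le
  intro χ hχ
  simpa using h χ (by simpa using hχ)

/-- A union of at most `2q` large deviation events of colour classes is exponentially unlikely. -/
theorem colouringProb_exists_tail_lt {V ι : Type*} [Fintype V] [Nonempty V] [Fintype ι]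
    (G : SimpleGraph V) [G.LocallyFinite] {d : ℕ} (hd : 0 < d) (hreg : G.IsRegularOfDegree d)
    (hbip : G.IsBipartite) {a a' : ℕ} (ha : 0 < a) (ha' : 0 < a')
    (hι : Fintype.card ι ≤ 2 * (a + a')) (k : ι → Fin (a + a')) (s : ι → ℝ) {b ε : ℝ}
    (hs : ∀ i, s i = 1 ∨ s i = -1) (hb : b ≤ 1)
    (hε : 4 * √((a + a' : ℕ) : ℝ) / √(d : ℝ) ≤ ε)
    (hopt : ε ≤ 1 → ∀ i, ∀ j : ℤ,
      (j + s i * ε / 8) * (a + a' - j) ≤ a * a' * (1 + 2 * b * (s i * ε / 8)))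
    (P : G.Coloring (Fin (a + a')) → Prop) (hP1 : ∀ χ, P χ → ε ≤ 1)
    (hP : ∀ χ, P χ → ∃ i, s i * b + ε ≤ s i * colourProportion χ (k i)) :
    colouringProb G (a + a') P < (2 * ((a + a' : ℕ) : ℝ) + 1) * ε⁻¹ *
      (2 : ℝ) ^ (-(1 / 32 * ε ^ 2 * (Fintype.card V : ℝ))) := by
  have hq : (0 : ℝ) < ((a + a' : ℕ) : ℝ) := by exact_mod_cast Nat.add_pos_left ha _
  have hd' : (0 : ℝ) < d := by exact_mod_cast hd
  have hε0 : 0 < ε := lt_of_lt_of_le (by positivity) hε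
  by_cases hε1 : ε ≤ 1
  swap
  · rw [colouringProb_eq_zero G P fun χ hχ => hε1 (hP1 χ hχ)]
    positivity
  have hdε : 16 * ((a + a' : ℕ) : ℝ) ≤ d * ε ^ 2 := by
    rw [div_le_iff₀ (by positivity)] at hε
    have := pow_le_pow_left₀ (by positivity) hε 2
    rw [mul_pow, mul_pow, Real.sq_sqrt hq.le, Real.sq_sqrt hd'.le] at this
    linarith
  have hsum := (colouringProb_le_sum G P _ hP).trans (Finset.sum_le_sum fun i _ =>
    colouringProb_tail_le G hd hreg hbip ha ha' (k i) (hs i) hb hε0.le hε1 hdε (hopt hε1 i) _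
      fun χ h => h)
  rw [Finset.sum_const, nsmul_eq_mul, Finset.card_univ] at hsum
  set y : ℝ := 1 / 32 * ε ^ 2 * (Fintype.card V : ℝ) with hy
  have hy0 : 0 ≤ y := by positivity
  have hexp : Real.exp (-(ε ^ 2 * Fintype.card V / 32)) ≤ (2 : ℝ) ^ (-y) := by
    rw [Real.rpow_def_of_pos two_pos]
    refine Real.exp_le_exp.2 ?_
    have h2 : Real.log 2 ≤ 1 := by linarith [Real.log_two_lt_d9]
    have : Real.log 2 * y ≤ 1 * y := by gcongr
    linarith
  have hpow : (0 : ℝ) < (2 : ℝ) ^ (-y) := by positivity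
  have hι' : (Fintype.card ι : ℝ) ≤ 2 * ((a + a' : ℕ) : ℝ) := by exact_mod_cast hι
  have hinv : 1 ≤ ε⁻¹ := (one_le_inv₀ hε0).2 hε1
  calc colouringProb G (a + a') P
      ≤ (2 * ((a + a' : ℕ) : ℝ)) * (2 : ℝ) ^ (-y) := hsum.trans (by gcongr)
    -- The extra 1 in `c₂` makes the bound strict; the factor `ε⁻¹ ≥ 1` is then free.
    _ < (2 * ((a + a' : ℕ) : ℝ) + 1) * (2 : ℝ) ^ (-y) := by gcongr; linarith
    _ = (2 * ((a + a' : ℕ) : ℝ) + 1) * 1 * (2 : ℝ) ^ (-y) := by ring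
    _ ≤ _ := by gcongr

/-! ### Optimal palette splits and the main theorem -/

/-- Integrality gives `|t| ≤ t ^ 2`. This keeps the balanced split optimal under a small
perturbation: `t` is the deviation from it. -/
theorem mul_le_sq_of_int {t : ℤ} {x : ℝ} (h1 : -1 ≤ x) (h2 : x ≤ 1) : x * t ≤ (t : ℝ) ^ 2 := by
  have ht : |(t : ℝ)| ≤ (t : ℝ) ^ 2 := by
    have : |t| ≤ t ^ 2 := by
      rw [← sq_abs]
      exact Int.le_self_sq _
    exact_mod_cast this
  calc x * t ≤ |x * t| := le_abs_self _
    _ = |x| * |(t : ℝ)| := abs_mul _ _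
    _ ≤ 1 * |(t : ℝ)| := by gcongr; exact abs_le.2 ⟨h1, h2⟩
    _ ≤ _ := by rwa [one_mul]

theorem corollary1p5 (q : ℕ) (hq : 2 ≤ q) :
    ∃ c₁ c₂ c₃ : ℝ, 0 < c₁ ∧ 0 < c₂ ∧ 0 < c₃ ∧
      ∀ (V : Type*) [Fintype V] [Nonempty V] (G : SimpleGraph V) [G.LocallyFinite] (d : ℕ),
        1 ≤ d → G.IsRegularOfDegree d → G.IsBipartite →
        ∀ ε : ℝ, c₁ / √(d : ℝ) ≤ ε →
          (Even q →
            colouringProb G q (fun χ => ∃ k : Fin q, ε ≤ |colourProportion χ k - 1 / (q : ℝ)|)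
              ≤ c₂ * ε⁻¹ * (2 : ℝ) ^ (-(c₃ * ε ^ 2 * (Fintype.card V : ℝ)))) ∧
          (Odd q →
            colouringProb G q
                (fun χ => ∃ k : Fin q, colourProportion χ k ≤ 1 / ((q : ℝ) + 1) - ε)
              < c₂ * ε⁻¹ * (2 : ℝ) ^ (-(c₃ * ε ^ 2 * (Fintype.card V : ℝ))) ∧
            colouringProb G q
                (fun χ => ∃ k : Fin q, 1 / ((q : ℝ) - 1) + ε ≤ colourProportion χ k)
              < c₂ * ε⁻¹ * (2 : ℝ) ^ (-(c₃ * ε ^ 2 * (Fintype.card V : ℝ)))) := by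
  have hq0 : (0 : ℝ) < q := by positivity
  refine ⟨4 * √(q : ℝ), 2 * (q : ℝ) + 1, 1 / 32, by positivity, by positivity, by norm_num, ?_⟩
  intro V _ _ G _ d hd hreg hbip ε hε
  have hd' : (0 : ℝ) < d := by exact_mod_cast hd
  have hε0 : 0 < ε := lt_of_lt_of_le (by positivity) hε
  constructor
  · rintro ⟨a, rfl⟩
    have ha : 0 < a := by omega
    have har : (0 : ℝ) < a := by exact_mod_cast ha
    have hb : 1 / ((a + a : ℕ) : ℝ) ≤ 1 := by
      rw [div_le_one hq0]
      exact_mod_cast (by omega : 1 ≤ a + a)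
    refine (colouringProb_exists_tail_lt (ι := Fin (a + a) × Bool) G hd hreg hbip ha ha
      (by simp [mul_comm]) Prod.fst (fun i => if i.2 then 1 else -1) ?_ hb hε ?_ _ ?_ ?_).le
    · rintro ⟨_, _ | _⟩ <;> simp
    · intro hε1 i j
      have hs : -1 ≤ (if i.2 then 1 else -1 : ℝ) ∧ (if i.2 then 1 else -1 : ℝ) ≤ 1 := by
        split_ifs <;> norm_num
      generalize (if i.2 then 1 else -1 : ℝ) = s at hs
      -- With `δ = s * ε / 8` and `t = a - j`, `(j + δ) * (2 * a - j) = a² + a * δ + (δ * t - t²)`.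
      have := mul_le_sq_of_int (t := a - j) (x := s * ε / 8) (by nlinarith) (by nlinarith)
      have e : (a * a * (1 + 2 * (1 / ((a + a : ℕ) : ℝ)) * (s * ε / 8)) : ℝ) =
          a * a + a * (s * ε / 8) := by
        push_cast
        field_simp
        ring
      rw [e]
      push_cast at this
      linarith
    · rintro χ ⟨k, hk⟩
      have h0 := colourProportion_nonneg χ k
      have h1 := colourProportion_le_one χ k
      have h2 : 0 ≤ 1 / ((a + a : ℕ) : ℝ) := by positivity
      refine hk.trans (abs_le.2 ⟨by linarith, by linarith⟩)
    · rintro χ ⟨k, hk⟩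
      rcases le_abs.1 hk with h | h
      · exact ⟨(k, true), by simp only [if_true]; linarith⟩
      · exact ⟨(k, false), by simp only [Bool.false_eq_true, if_false]; linarith⟩
  · rintro ⟨m, hm⟩
    obtain rfl : q = m + (m + 1) := by omega
    have hm0 : 0 < m := by omega
    have hmr : (1 : ℝ) ≤ m := by exact_mod_cast hm0
    constructor
    · refine colouringProb_exists_tail_lt (ι := Fin (m + (m + 1))) G hd hreg hbip hm0
        (Nat.succ_pos m) (by simp) id (fun _ => -1) (b := 1 / (((m + (m + 1) : ℕ) : ℝ) + 1))
        (by simp) ?_ hε ?_ _ ?_ ?_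
      · rw [div_le_one (by positivity)]
        linarith
      · intro hε1 i j
        -- For `δ < 0` the optimum is `j = m + 1`, with `k` on the larger side.
        have := mul_le_sq_of_int (t := j - (m + 1)) (x := -1 + ε / 8) (by linarith) (by linarith)
        have e : (m * ((m + 1 : ℕ) : ℝ) *
            (1 + 2 * (1 / (((m + (m + 1) : ℕ) : ℝ) + 1)) * (-1 * ε / 8)) : ℝ) =
            m * (m + 1) + m * (-1 * ε / 8) := by
          push_cast
          field_simp
          ring
        rw [e]
        push_cast at this ⊢
        linarith
      · rintro χ ⟨k, hk⟩
        have h0 := colourProportion_nonneg χ k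
        have h2 : 1 / (((m + (m + 1) : ℕ) : ℝ) + 1) ≤ 1 := by
          rw [div_le_one (by positivity)]
          linarith
        linarith
      · rintro χ ⟨k, hk⟩
        exact ⟨k, by simp only [id]; linarith⟩
    · have hq1 : (((m + (m + 1) : ℕ) : ℝ) - 1) = 2 * m := by push_cast; ring
      rw [hq1]
      refine colouringProb_exists_tail_lt (ι := Fin (m + (m + 1))) G hd hreg hbip hm0
        (Nat.succ_pos m) (by simp) id (fun _ => 1) (b := 1 / (2 * (m : ℝ)))
        (by simp) ?_ hε ?_ _ ?_ ?_
      · rw [div_le_one (by positivity)]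
        linarith
      · intro hε1 i j
        -- For `δ > 0` the optimum is `j = m`, with `k` on the smaller side.
        have := mul_le_sq_of_int (t := j - m) (x := 1 - ε / 8) (by linarith) (by linarith)
        have e : (m * ((m + 1 : ℕ) : ℝ) * (1 + 2 * (1 / (2 * (m : ℝ))) * (1 * ε / 8)) : ℝ) =
            m * (m + 1) + (m + 1) * (1 * ε / 8) := by
          push_cast
          field_simp
        rw [e]
        push_cast at this ⊢
        linarith
      · rintro χ ⟨k, hk⟩
        have h1 := colourProportion_le_one χ k
        have h2 : 0 ≤ 1 / (2 * (m : ℝ)) := by positivity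
        linarith
      · rintro χ ⟨k, hk⟩
        exact ⟨k, by simp only [id]; linarith⟩
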